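/- Let $X$ and $Y$ be Banach spaces (both real or both complex), with $X$ separable and reflexive. Let $\mathcal{L}$ be a collection (repetitions allowed) of bounded linear operators $L : X \to Y$, equipped with a $\sigma$-compact, locally compact Hausdorff topology $\tau$ such that for every $x \in X$ the map $\mathcal{L} \to Y$, $L \mapsto Lx$, is continuous for the norm topology of $Y$. Let $\varlimsup_{L\to\infty}$ denote the upper limit as $L \in \mathcal L$ tends to the point at infinity of the one-point compactification of $(\mathcal{L},\tau)$; for nonnegative functions it is taken to be $0$ if $\mathcal{L}$ is compact. Put $$M(X,\mathcal{L}) = \Big\{x \in X : \sup_{L \in \mathcal{L}} \|Lx\|_Y < \infty\Big\}, \qquad M_0(X,\mathcal{L}) = \Big\{x \in M(X,\mathcal{L}) : \varlimsup_{L\to\infty} \|Lx\|_Y = 0\Big\},$$ and suppose that $\|x\|_{M(X,\mathcal{L})} = \sup_{L\in\mathcal{L}} \|Lx\|_Y$ defines a norm which makes $M(X,\mathcal{L})$ a Banach space continuously contained in $X$. Assume that for every $x \in M(X,\mathcal{L})$ there is a sequence $(x_n)$ in $M_0(X,\mathcal{L})$ such that $x_n \to x$ in $X$ and $\sup_n \|x_n\|_{M(X,\mathcal{L})}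 < \infty$. Then for every $x \in M(X,\mathcal{L})$, $$\inf_{x_0 \in M_0(X,\mathcal{L})} \|x - x_0\|_{M(X,\mathcal{L})} = \varlimsup_{L\to\infty} \|Lx\|_Y .$$ -/

import Mathlib

open Filter Topology Set

noncomputable section

namespace BigOSpace

variable {𝕜 X Y ι : Type*} [RCLike 𝕜]
  [NormedAddCommGroup X] [NormedSpace 𝕜 X]
  [NormedAddCommGroup Y] [NormedSpace 𝕜 Y]

/-- The canonical embedding of `X` into its bidual is onto. -/
def IsReflexive (𝕜 X : Type*) [RCLike 𝕜] [NormedAddCommGroup X] [NormedSpace 𝕜 X] : Prop :=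
  Function.Surjective (NormedSpace.inclusionInDoubleDual 𝕜 X)

/-- The linear subspace of those `x : X` for which `sup_i ‖L i x‖` is finite. -/
def bigSubmodule (L : ι → X →L[𝕜] Y) : Submodule 𝕜 X where
  carrier := {x | BddAbove (range fun i => ‖L i x‖)}
  zero_mem' := ⟨0, by rintro _ ⟨i, rfl⟩; simp⟩
  add_mem' := by
    rintro x y ⟨a, ha⟩ ⟨b, hb⟩
    refine ⟨a + b, ?_⟩
    rintro _ ⟨i, rfl⟩
    simp only [map_add]
    exact (norm_add_le _ _).trans (add_le_add (ha ⟨i, rfl⟩) (hb ⟨i, rfl⟩))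
  smul_mem' := by
    rintro c x ⟨a, ha⟩
    refine ⟨‖c‖ * a, ?_⟩
    rintro _ ⟨i, rfl⟩
    simp only [map_smul, norm_smul]
    exact mul_le_mul_of_nonneg_left (ha ⟨i, rfl⟩) (norm_nonneg c)

/-- The space `M(X, 𝓛)`. It is a type of its own, since its norm is not the one inherited
from `X`. -/
def M (L : ι → X →L[𝕜] Y) : Type _ := ↥(bigSubmodule L)

namespace M

variable (L : ι → X →L[𝕜] Y)

instance : AddCommGroup (M L) := inferInstanceAs (AddCommGroup ↥(bigSubmodule L))

instance : Module 𝕜 (M L) := inferInstanceAs (Module 𝕜 ↥(bigSubmodule L))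

/-- The inclusion of `M(X, 𝓛)` in `X`. -/
def incl : M L →ₗ[𝕜] X := (bigSubmodule L).subtype

variable {L}

theorem bdd (x : M L) : BddAbove (range fun i => ‖L i (incl L x)‖) := x.2

variable (L)

/-- The functional `x ↦ sup_i ‖L i x‖` on `M(X, 𝓛)`. -/
def supNorm : AddGroupSeminorm (M L) where
  toFun x := ⨆ i, ‖L i (incl L x)‖
  map_zero' := by simp
  add_le' x y := by
    refine Real.iSup_le (fun i => ?_) (add_nonneg
      (Real.iSup_nonneg fun i => norm_nonneg _) (Real.iSup_nonneg fun i => norm_nonneg _))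
    simp only [map_add]
    exact (norm_add_le _ _).trans (add_le_add (le_ciSup (bdd x) i) (le_ciSup (bdd y) i))
  neg' x := by simp

/-- `M(X, 𝓛)` with `‖x‖ = sup_i ‖L i x‖`, in general only a seminorm. -/
instance : SeminormedAddCommGroup (M L) := (supNorm L).toSeminormedAddCommGroup

theorem norm_def (x : M L) : ‖x‖ = ⨆ i, ‖L i (incl L x)‖ := rfl

end M

/-- The upper limit of `‖L i x‖` as `i` tends to the point at infinity of the one-point
compactification of the index space. -/
def limsupInfty [TopologicalSpace ι] (L : ι → X →L[𝕜] Y) (x : X) : ℝ :=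
  limsup (fun i => ‖L i x‖) (comap ((↑) : ι → OnePoint ι) (𝓝 OnePoint.infty))

/-- The little space `M₀(X, 𝓛)`, as a subset of `M(X, 𝓛)`. -/
def M₀ [TopologicalSpace ι] (L : ι → X →L[𝕜] Y) : Set (M L) :=
  {x | limsupInfty L (M.incl L x) = 0}

/-- Every `x` in `M(X, 𝓛)` is the limit in `X` of a sequence in `M₀(X, 𝓛)` that is bounded
in the norm of `M(X, 𝓛)`. -/
def BoundedApproximation [TopologicalSpace ι] (L : ι → X →L[𝕜] Y) : Prop :=
  ∀ x : M L, ∃ u : ℕ → M L, (∀ n, u n ∈ M₀ L) ∧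
    Tendsto (fun n => M.incl L (u n)) atTop (𝓝 (M.incl L x)) ∧
    BddAbove (range fun n => ‖u n‖)

end BigOSpace

end

namespace BigOSpace

section Limsup

variable {α : Type*} {f : α → ℝ} {F : Filter α}

/-! Subtracting an element of `M₀` does not change the behaviour at infinity, so the upper limit
bounds the distance from below. Conversely, average N approximants `u n`, chosen as a gliding hump
(`exists_mem_M₀_norm_nsmul_sub_le`). At each index at most one summand costs the full bound C; the
others cost about `‖L i x‖` or almost nothing. Averaging shrinks C to C / N, while on a prescribed
compact set the whole error is small. -/

theorem limsup_le_of_eventually_le_of_nonneg (hf : ∀ i, 0 ≤ f i) {a : ℝ} (ha : 0 ≤ a)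
    (h : ∀ᶠ i in F, f i ≤ a) : limsup f F ≤ a := by
  -- For `F = ⊥` (compact index space) the real limsup is `sInf univ = 0`, hence `ha`.
  rcases F.eq_or_neBot with rfl | _
  · simpa [limsup_eq] using ha
  · exact limsup_le_of_le (isCoboundedUnder_le_of_le F hf) h

theorem limsup_nonneg_of_nonneg (hf : ∀ i, 0 ≤ f i) (hb : BddAbove (range f)) :
    0 ≤ limsup f F := by
  rcases F.eq_or_neBot with rfl | _
  · simp [limsup_eq]
  · exact le_limsup_of_frequently_le (Frequently.of_forall hf) hb.isBoundedUnder_of_range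

end Limsup

variable {𝕜 X Y ι : Type*} [RCLike 𝕜]
  [NormedAddCommGroup X] [NormedSpace 𝕜 X]
  [NormedAddCommGroup Y] [NormedSpace 𝕜 Y]
  {L : ι → X →L[𝕜] Y}

theorem M.norm_apply_le (x : M L) (i : ι) : ‖L i (M.incl L x)‖ ≤ ‖x‖ :=
  le_ciSup (M.bdd x) i

theorem M.norm_le {x : M L} {a : ℝ} (ha : 0 ≤ a) (h : ∀ i, ‖L i (M.incl L x)‖ ≤ a) :
    ‖x‖ ≤ a :=
  Real.iSup_le h ha

variable [TopologicalSpace ι]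

theorem limsupInfty_eq_limsup_cocompact [T2Space ι] (x : X) :
    limsupInfty L x = limsup (fun i => ‖L i x‖) (cocompact ι) := by
  rw [limsupInfty, OnePoint.comap_coe_nhds_infty, coclosedCompact_eq_cocompact]

theorem limsupInfty_nonneg (x : M L) : 0 ≤ limsupInfty L (M.incl L x) :=
  limsup_nonneg_of_nonneg (fun _ => norm_nonneg _) (M.bdd x)

theorem eventually_norm_lt_of_limsupInfty_lt [T2Space ι] (x : M L) {a : ℝ}
    (h : limsupInfty L (M.incl L x) < a) :
    ∀ᶠ i in cocompact ι, ‖L i (M.incl L x)‖ < a := by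
  rw [limsupInfty_eq_limsup_cocompact] at h
  exact eventually_lt_of_limsup_lt h (M.bdd x).isBoundedUnder_of_range

theorem limsupInfty_le [T2Space ι] (x : X) {a : ℝ} (ha : 0 ≤ a)
    (h : ∀ᶠ i in cocompact ι, ‖L i x‖ ≤ a) : limsupInfty L x ≤ a := by
  rw [limsupInfty_eq_limsup_cocompact]
  exact limsup_le_of_eventually_le_of_nonneg (fun _ => norm_nonneg _) ha h

theorem mem_M₀_iff [T2Space ι] {x : M L} :
    x ∈ M₀ L ↔ ∀ ε > 0, ∀ᶠ i in cocompact ι, ‖L i (M.incl L x)‖ < ε := by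
  refine ⟨fun h ε hε => eventually_norm_lt_of_limsupInfty_lt x ?_, fun h => ?_⟩
  · rwa [show limsupInfty L (M.incl L x) = 0 from h]
  · refine le_antisymm (le_of_forall_pos_le_add fun ε hε => ?_) (limsupInfty_nonneg x)
    rw [zero_add]
    exact limsupInfty_le _ hε.le ((h ε hε).mono fun _ => le_of_lt)

theorem zero_mem_M₀ [T2Space ι] : (0 : M L) ∈ M₀ L :=
  mem_M₀_iff.2 fun ε hε => by simpa using Eventually.of_forall fun _ => hε

theorem add_mem_M₀ [T2Space ι] {x y : M L} (hx : x ∈ M₀ L) (hy : y ∈ M₀ L) :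
    x + y ∈ M₀ L := by
  refine mem_M₀_iff.2 fun ε hε => ?_
  filter_upwards [mem_M₀_iff.1 hx _ (half_pos hε), mem_M₀_iff.1 hy _ (half_pos hε)] with i h₁ h₂
  rw [map_add, map_add]
  linarith [norm_add_le (L i (M.incl L x)) (L i (M.incl L y))]

theorem smul_mem_M₀ [T2Space ι] (c : 𝕜) {x : M L} (hx : x ∈ M₀ L) : c • x ∈ M₀ L := by
  refine mem_M₀_iff.2 fun ε hε => ?_
  filter_upwards [mem_M₀_iff.1 hx (ε / (‖c‖ + 1)) (by positivity)] with i hi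
  rw [lt_div_iff₀ (by positivity)] at hi
  rw [map_smul, map_smul, norm_smul]
  nlinarith [norm_nonneg (L i (M.incl L x))]

/-- A pointwise continuous family of operators is uniformly bounded on compact sets, by
Banach–Steinhaus. -/
theorem exists_norm_le_of_isCompact [CompleteSpace X]
    (hL : ∀ x : X, Continuous fun i => L i x) {K : Set ι} (hK : IsCompact K) :
    ∃ C, ∀ i ∈ K, ‖L i‖ ≤ C := by
  obtain ⟨C, hC⟩ := banach_steinhaus (g := fun i : K => L i) fun x => by
    obtain ⟨B, hB⟩ := hK.exists_bound_of_continuousOn (hL x).continuousOn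
    exact ⟨B, fun i => hB i i.2⟩
  exact ⟨C, fun i hi => hC ⟨i, hi⟩⟩

theorem eventually_forall_norm_apply_sub_le [CompleteSpace X]
    (hL : ∀ x : X, Continuous fun i => L i x) {K : Set ι} (hK : IsCompact K)
    {u : ℕ → X} {x : X} (hu : Tendsto u atTop (𝓝 x)) {δ : ℝ} (hδ : 0 < δ) :
    ∀ᶠ n in atTop, ∀ i ∈ K, ‖L i (x - u n)‖ ≤ δ := by
  obtain ⟨C, hC⟩ := exists_norm_le_of_isCompact hL hK
  have h0 : Tendsto (fun n => C * ‖x - u n‖) atTop (𝓝 0) := by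
    simpa using ((tendsto_const_nhds (x := x)).sub hu).norm.const_mul C
  filter_upwards [h0.eventually_lt_const hδ] with n hn i hi
  exact ((L i).le_of_opNorm_le (hC i hi) _).trans hn.le

/-- Gliding hump: a sum `s` of `N` elements of `M₀`, each close to `x` on a large compact set
chosen after the preceding ones, approximates `N • x` on `K`, and at each index at most one
summand contributes an error not controlled by `‖L i x‖`. -/
theorem exists_mem_M₀_norm_nsmul_sub_le [CompleteSpace X] [T2Space ι]
    (hL : ∀ x : X, Continuous fun i => L i x) {x : M L} {u : ℕ → M L}
    (hu : ∀ n, u n ∈ M₀ L) (hux : Tendsto (fun n => M.incl L (u n)) atTop (𝓝 (M.incl L x)))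
    {C : ℝ} (hC : 0 ≤ C) (huC : ∀ n, ‖x - u n‖ ≤ C) {K : Set ι} (hK : IsCompact K)
    (N : ℕ) {δ : ℝ} (hδ : 0 < δ) :
    ∃ s ∈ M₀ L, (∀ i ∈ K, ‖L i (M.incl L (N • x - s))‖ ≤ δ) ∧
      ∀ i, ‖L i (M.incl L (N • x - s))‖ ≤ N * ‖L i (M.incl L x)‖ + C + δ := by
  induction N generalizing δ with
  | zero =>
    refine ⟨0, zero_mem_M₀, fun i _ => ?_, fun i => ?_⟩
    · simpa using hδ.le
    · simpa using add_nonneg hC hδ.le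
  | succ N ih =>
    obtain ⟨s, hs, hsK, hsN⟩ := ih (half_pos hδ)
    obtain ⟨K', hK', hsK'⟩ := mem_cocompact.1 (mem_M₀_iff.1 hs _ (half_pos hδ))
    obtain ⟨n, hn⟩ := (eventually_forall_norm_apply_sub_le hL (hK.union hK') hux
      (half_pos hδ)).exists
    have key : ∀ i, ‖L i (M.incl L ((N + 1) • x - (s + u n)))‖ ≤
        ‖L i (M.incl L (N • x - s))‖ + ‖L i (M.incl L x - M.incl L (u n))‖ := fun i => by
      rw [show (N + 1) • x - (s + u n) = (N • x - s) + (x - u n) by rw [succ_nsmul]; abel,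
        map_add, map_add, map_sub _ x]
      exact norm_add_le _ _
    refine ⟨s + u n, add_mem_M₀ hs (hu n), fun i hi => ?_, fun i => ?_⟩
    · linarith [key i, hsK i hi, hn i (Or.inl hi)]
    · have hx := norm_nonneg (L i (M.incl L x))
      push_cast
      -- On `K'` the new term is accurate, so C is not spent again; off `K'` the old sum `s` is
      -- negligible, so only the new term spends C.
      by_cases hi : i ∈ K'
      · linarith [key i, hsN i, hn i (Or.inr hi)]
      · have hsi : ‖L i (M.incl L s)‖ < δ / 2 := hsK' hi
        have h₁ : ‖L i (M.incl L (N • x - s))‖ ≤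
            N * ‖L i (M.incl L x)‖ + ‖L i (M.incl L s)‖ := by
          rw [map_sub, map_sub, map_nsmul, map_nsmul]
          exact (norm_sub_le _ _).trans (add_le_add_left norm_nsmul_le _)
        have h₂ : ‖L i (M.incl L x - M.incl L (u n))‖ ≤ C := by
          rw [← map_sub]
          exact (M.norm_apply_le _ i).trans (huC n)
        linarith [key i]

theorem limsupInfty_le_infDist [T2Space ι] (x : M L) :
    limsupInfty L (M.incl L x) ≤ Metric.infDist x (M₀ L) := by
  refine (Metric.le_infDist ⟨0, zero_mem_M₀⟩).2 fun y hy => ?_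
  rw [dist_eq_norm]
  refine le_of_forall_pos_le_add fun ε hε => limsupInfty_le _ (by positivity) ?_
  filter_upwards [mem_M₀_iff.1 hy ε hε] with i hi
  have h := M.norm_apply_le (x - y) i
  rw [map_sub, map_sub] at h
  linarith [norm_sub_norm_le (L i (M.incl L x)) (L i (M.incl L y))]

/-- The approximant is `s / N`. The compact set `K` holds every index where `‖L i x‖` exceeds the
upper limit by ε / 2 or more. -/
theorem infDist_le_limsupInfty [CompleteSpace X] [T2Space ι]
    (hL : ∀ x : X, Continuous fun i => L i x) (happrox : BoundedApproximation L) (x : M L) :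
    Metric.infDist x (M₀ L) ≤ limsupInfty L (M.incl L x) := by
  obtain ⟨u, hu, hux, B, hB⟩ := happrox x
  have huC : ∀ n, ‖x - u n‖ ≤ ‖x‖ + B := fun n =>
    (norm_sub_le _ _).trans (add_le_add_right (hB ⟨n, rfl⟩) _)
  have hC : 0 ≤ ‖x‖ + B := (norm_nonneg _).trans (huC 0)
  refine le_of_forall_pos_le_add fun ε hε => ?_
  have hℓ := limsupInfty_nonneg x
  obtain ⟨K, hK, hxK⟩ := mem_cocompact.1
    (eventually_norm_lt_of_limsupInfty_lt x (lt_add_of_pos_right _ (half_pos hε)))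
  -- Makes the hump's surplus C + ε / 2, with C = `‖x‖ + B`, at most ε / 2 after division by N.
  obtain ⟨N, hN⟩ := exists_nat_gt ((‖x‖ + B + ε / 2) / (ε / 2))
  have hN0 : (0 : ℝ) < N := lt_of_le_of_lt (by positivity) hN
  have hN1 : (1 : ℝ) ≤ N := by exact_mod_cast (Nat.cast_pos.1 hN0 : 0 < N)
  rw [div_lt_iff₀ (half_pos hε)] at hN
  obtain ⟨s, hs, hsK, hsN⟩ :=
    exists_mem_M₀_norm_nsmul_sub_le hL hu hux hC huC hK N (half_pos hε)
  have hN𝕜 : (N : 𝕜) ≠ 0 := by exact_mod_cast hN0.ne'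
  refine (Metric.infDist_le_dist_of_mem (smul_mem_M₀ (N : 𝕜)⁻¹ hs)).trans ?_
  rw [dist_eq_norm]
  refine M.norm_le (by positivity) fun i => ?_
  have hi : ‖L i (M.incl L (x - (N : 𝕜)⁻¹ • s))‖ =
      (N : ℝ)⁻¹ * ‖L i (M.incl L (N • x - s))‖ := by
    rw [show x - (N : 𝕜)⁻¹ • s = (N : 𝕜)⁻¹ • (N • x - s) by
      rw [smul_sub, ← Nat.cast_smul_eq_nsmul 𝕜 N x, inv_smul_smul₀ hN𝕜],
      map_smul, map_smul, norm_smul, norm_inv, RCLike.norm_natCast]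
  rw [hi, inv_mul_le_iff₀ hN0]
  by_cases hiK : i ∈ K
  · nlinarith [hsK i hiK]
  · have hxi : ‖L i (M.incl L x)‖ < limsupInfty L (M.incl L x) + ε / 2 := hxK hiK
    nlinarith [hsN i]

end BigOSpace

theorem theorem2 {𝕜 X Y ι : Type*} [RCLike 𝕜]
    [NormedAddCommGroup X] [NormedSpace 𝕜 X] [CompleteSpace X]
    [TopologicalSpace.SeparableSpace X] (hX : BigOSpace.IsReflexive 𝕜 X)
    [NormedAddCommGroup Y] [NormedSpace 𝕜 Y] [CompleteSpace Y]
    [TopologicalSpace ι] [T2Space ι] [LocallyCompactSpace ι] [SigmaCompactSpace ι]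
    (L : ι → X →L[𝕜] Y)
    (hL : ∀ x : X, Continuous fun i => L i x)
    (hnorm : ∀ x : BigOSpace.M L, ‖x‖ = 0 → x = 0)
    (hcomplete : CompleteSpace (BigOSpace.M L))
    (hincl : Continuous (BigOSpace.M.incl L))
    (happrox : BigOSpace.BoundedApproximation L)
    (x : BigOSpace.M L) :
    Metric.infDist x (BigOSpace.M₀ L) = BigOSpace.limsupInfty L (BigOSpace.M.incl L x) :=
  le_antisymm (BigOSpace.infDist_le_limsupInfty hL happrox x)
    (BigOSpace.limsupInfty_le_infDist x)
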